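/- Let $H_0$ be the space of germs at $0$ of functions holomorphic in a neighbourhood of $0\in\mathbb{C}$, with the inductive limit topology $H_0=\operatorname{ind}_k A(\overline{B(0,1/k)})$: here, for $k=1,2,\dots$, $A(\overline{B(0,1/k)})$ is the Banach space of continuous functions on the closed disc $\overline{B(0,1/k)}$ that are holomorphic in its interior, with the supremum norm, and $H_0$ carries the finest locally convex topology for which all the canonical maps $A(\overline{B(0,1/k)})\to H_0$ are continuous. The Cesàro operator $C$ on $H_0$ sends the germ of $\sum_{n\ge 0} a_n z^n$ to the germ of $\sum_{n\ge 0}\frac{a_0+a_1+\dots+a_n}{n+1}z^n$. For a continuous linear operator $T$ on a locally convex Hausdorff space $X$, let $\rho(T;X)$ be the set of $\lambda\in\mathbb{C}$ for which $\lambda I-T$ has an inverse in the algebra of continuous linear operators on $X$; let $\sigma(T;X)=\mathbb{C}\setminus\rho(T;X)$; let $\sigma_{pt}(T;X)$ be the set of $\lambda$ for which $\lambda I-T$ is not injective; let $\rho^*(T;X)$ be the set of $\lambda$ for which there is $\delta>0$ such that $B(\lambda,\delta)\subseteq\rho(T;X)$ and the family $\{(\mu I-T)^{-1}:\mu\in B(\lambda,\delta)\}$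 is equicontinuous; and let $\sigma^*(T;X)=\mathbb{C}\setminus\rho^*(T;X)$. The operator $T$ is compact (weakly compact) if it maps some neighbourhood of $0$ to a relatively compact (relatively weakly compact) set. Proposition 2.14. The Cesàro operator $C:H_0\to H_0$ is continuous, with spectra $$\sigma(C;H_0)=\sigma_{pt}(C;H_0)=\{\tfrac1n : n=1,2,3,\dots\},\qquad \sigma^*(C;H_0)=\{0\}\cup\{\tfrac1n : n=1,2,3,\dots\}.$$ In particular, $C$ is neither compact nor weakly compact. -/

import Mathlib

open Filter Topology Set

noncomputable section

/-! ## Germs of holomorphic functions at `0` -/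

/-- The germs at `0` of functions `ℂ → ℂ` which are holomorphic in a neighbourhood of `0`, as a
subspace of the space of all germs at `0`. -/
def holGermSubmodule : Submodule ℂ (Germ (𝓝 (0 : ℂ)) ℂ) where
  carrier := {g | ∃ f : ℂ → ℂ, AnalyticAt ℂ f 0 ∧ (f : Germ (𝓝 (0 : ℂ)) ℂ) = g}
  add_mem' := by
    rintro _ _ ⟨f, hf, rfl⟩ ⟨g, hg, rfl⟩
    exact ⟨f + g, hf.add hg, rfl⟩
  zero_mem' := ⟨0, analyticAt_const, rfl⟩
  smul_mem' := by
    rintro c _ ⟨f, hf, rfl⟩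
    exact ⟨c • f, analyticAt_const.smul hf, rfl⟩

/-- The space `H₀` of germs of holomorphic functions at `0 ∈ ℂ`. -/
def HolGerm : Type := holGermSubmodule

namespace HolGerm

instance : AddCommGroup HolGerm := inferInstanceAs (AddCommGroup holGermSubmodule)

instance : Module ℂ HolGerm := inferInstanceAs (Module ℂ holGermSubmodule)

/-- The germ at `0` of a function that is holomorphic near `0`. -/
def of (f : ℂ → ℂ) (hf : AnalyticAt ℂ f 0) : HolGerm := ⟨(f : Germ (𝓝 (0 : ℂ)) ℂ), f, hf, rfl⟩

theorem exists_of (g : HolGerm) : ∃ (f : ℂ → ℂ) (hf : AnalyticAt ℂ f 0), g = of f hf := by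
  obtain ⟨g, f, hf, rfl⟩ := g
  exact ⟨f, hf, rfl⟩

theorem of_eq_of {f g : ℂ → ℂ} {hf : AnalyticAt ℂ f 0} {hg : AnalyticAt ℂ g 0} :
    of f hf = of g hg ↔ f =ᶠ[𝓝 0] g := by
  constructor
  · intro h
    exact Germ.coe_eq.1 (congrArg Subtype.val h)
  · intro h
    exact Subtype.ext (Germ.coe_eq.2 h)

theorem of_add {f g : ℂ → ℂ} (hf : AnalyticAt ℂ f 0) (hg : AnalyticAt ℂ g 0) :
    of f hf + of g hg = of (f + g) (hf.add hg) := rfl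

theorem smul_of (c : ℂ) {f : ℂ → ℂ} (hf : AnalyticAt ℂ f 0) :
    c • of f hf = of (c • f) (analyticAt_const.smul hf) := rfl

end HolGerm

/-! ## The disc algebras and the inductive limit topology -/

/-- The disc algebra `A(closedBall 0 r)`: the continuous functions on the closed disc of radius `r`
which are holomorphic on the open disc, with the supremum norm (inherited from the space of
continuous functions on the compact disc). -/
def discAlgebra (r : ℝ) : Submodule ℂ C(Metric.closedBall (0 : ℂ) r, ℂ) where
  carrier := {u | ∃ F : ℂ → ℂ, DifferentiableOn ℂ F (Metric.ball 0 r) ∧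
    ∀ z : Metric.closedBall (0 : ℂ) r, F z = u z}
  add_mem' := by
    rintro u v ⟨F, hF, hFu⟩ ⟨G, hG, hGv⟩
    exact ⟨F + G, hF.add hG, fun z => by simp [hFu z, hGv z]⟩
  zero_mem' := ⟨0, differentiableOn_const 0, fun z => rfl⟩
  smul_mem' := by
    rintro c u ⟨F, hF, hFu⟩
    exact ⟨c • F, hF.const_smul c, fun z => by simp [hFu z]⟩

open Classical in
/-- The extension of a function on the closed disc of radius `r` by `0` outside of that disc. -/
def discExtend (r : ℝ) (u : C(Metric.closedBall (0 : ℂ) r, ℂ)) : ℂ → ℂ :=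
  fun z => if hz : z ∈ Metric.closedBall (0 : ℂ) r then u ⟨z, hz⟩ else 0

theorem discExtend_of_mem {r : ℝ} (u : C(Metric.closedBall (0 : ℂ) r, ℂ)) {z : ℂ}
    (hz : z ∈ Metric.closedBall (0 : ℂ) r) : discExtend r u z = u ⟨z, hz⟩ := dif_pos hz

theorem discExtend_analyticAt {r : ℝ} (hr : 0 < r) (u : discAlgebra r) :
    AnalyticAt ℂ (discExtend r u.1) 0 := by
  obtain ⟨u, F, hF, hFu⟩ := u
  have hA : AnalyticAt ℂ F 0 := hF.analyticAt (Metric.ball_mem_nhds 0 hr)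
  refine hA.congr ?_
  filter_upwards [Metric.closedBall_mem_nhds (0 : ℂ) hr] with z hz
  rw [discExtend_of_mem _ hz]
  exact hFu ⟨z, hz⟩

/-- The canonical linear map from the disc algebra of radius `r > 0` to the germs at `0`. -/
def discToGerm (r : ℝ) (hr : 0 < r) : discAlgebra r →ₗ[ℂ] HolGerm where
  toFun u := HolGerm.of (discExtend r u.1) (discExtend_analyticAt hr u)
  map_add' u v := by
    rw [HolGerm.of_add, HolGerm.of_eq_of]
    refine Eventually.of_forall fun z => ?_
    by_cases hz : z ∈ Metric.closedBall (0 : ℂ) r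
    · simp only [discExtend, Pi.add_apply, dif_pos hz]; rfl
    · simp only [discExtend, Pi.add_apply, dif_neg hz]; simp
  map_smul' c u := by
    rw [RingHom.id_apply, HolGerm.smul_of, HolGerm.of_eq_of]
    refine Eventually.of_forall fun z => ?_
    by_cases hz : z ∈ Metric.closedBall (0 : ℂ) r
    · simp only [discExtend, Pi.smul_apply, dif_pos hz]; rfl
    · simp only [discExtend, Pi.smul_apply, dif_neg hz]; simp

namespace HolGerm

/-- The radii `1, 1/2, 1/3, …` of the steps of the inductive limit. -/
def stepRadius (k : ℕ) : ℝ := 1 / ((k : ℝ) + 1)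

theorem stepRadius_pos (k : ℕ) : 0 < stepRadius k := by
  unfold stepRadius
  positivity

/-- The topologies on `H₀` that are locally convex vector space topologies and make all the maps
`A(closedBall 0 (1/k)) → H₀`, `k = 1, 2, …`, continuous. -/
def stepTopologies : Set (TopologicalSpace HolGerm) :=
  {t | @IsTopologicalAddGroup HolGerm t _ ∧ @ContinuousSMul ℂ HolGerm _ _ t ∧
    @LocallyConvexSpace ℝ HolGerm _ _ _ _ t ∧
    ∀ k : ℕ, @Continuous (discAlgebra (stepRadius k)) HolGerm _ t
      (discToGerm (stepRadius k) (stepRadius_pos k))}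

/-- The topology of `H₀ = ind_k A(closedBall 0 (1/k))`: the finest locally convex topology for which
all the maps `A(closedBall 0 (1/k)) → H₀` are continuous. (In Mathlib's order on topologies, the
finest one is the infimum.) -/
instance : TopologicalSpace HolGerm := sInf stepTopologies

instance : IsTopologicalAddGroup HolGerm :=
  topologicalAddGroup_sInf fun _ ht => ht.1

instance : ContinuousSMul ℂ HolGerm :=
  continuousSMul_sInf fun _ ht => ht.2.1

instance : LocallyConvexSpace ℝ HolGerm :=
  LocallyConvexSpace.sInf fun _ ht => ht.2.2.1

theorem continuous_discToGerm (k : ℕ) :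
    Continuous (discToGerm (stepRadius k) (stepRadius_pos k)) :=
  continuous_sInf_rng.2 fun _ ht => ht.2.2.2 k

end HolGerm

/-! ## The Cesàro operator -/

/-- The discrete Cesàro operator on the space of all complex sequences; with indices starting at
`0` it sends `x` to the sequence of the means `(x 0 + ⋯ + x n) / (n + 1)`. -/
def cesaroSeq : (ℕ → ℂ) →ₗ[ℂ] (ℕ → ℂ) where
  toFun x n := (∑ i ∈ Finset.range (n + 1), x i) / ((n : ℂ) + 1)
  map_add' x y := by
    funext n
    simp [Finset.sum_add_distrib, add_div]
  map_smul' c x := by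
    funext n
    simp [← Finset.mul_sum, mul_div_assoc]

namespace HolGerm

/-- The `n`-th Taylor coefficient at `0` of a germ. -/
def coeff (g : HolGerm) (n : ℕ) : ℂ :=
  g.1.liftOn (fun f => iteratedDeriv n f 0 / (n.factorial : ℂ)) fun f₁ f₂ h => by
    show iteratedDeriv n f₁ 0 / (n.factorial : ℂ) = iteratedDeriv n f₂ 0 / (n.factorial : ℂ)
    rw [h.iteratedDeriv_eq n]

theorem coeff_of (f : ℂ → ℂ) (hf : AnalyticAt ℂ f 0) (n : ℕ) :
    coeff (of f hf) n = iteratedDeriv n f 0 / (n.factorial : ℂ) := rfl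

theorem hasFPowerSeriesAt_of (f : ℂ → ℂ) (hf : AnalyticAt ℂ f 0) :
    HasFPowerSeriesAt f (FormalMultilinearSeries.ofScalars ℂ (coeff (of f hf))) 0 :=
  hf.hasFPowerSeriesAt

/-- A germ is determined by its Taylor coefficients. -/
theorem coeff_injective : Function.Injective coeff := by
  intro g h hgh
  obtain ⟨f₁, hf₁, rfl⟩ := exists_of g
  obtain ⟨f₂, hf₂, rfl⟩ := exists_of h
  rw [of_eq_of]
  have h1 := hasFPowerSeriesAt_of f₁ hf₁
  have h2 := hasFPowerSeriesAt_of f₂ hf₂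
  rw [hgh] at h1
  filter_upwards [h1.eventually_hasSum_sub, h2.eventually_hasSum_sub] with z hz1 hz2
  exact hz1.unique hz2

theorem coeff_add (g h : HolGerm) : coeff (g + h) = coeff g + coeff h := by
  obtain ⟨f₁, hf₁, rfl⟩ := exists_of g
  obtain ⟨f₂, hf₂, rfl⟩ := exists_of h
  funext n
  rw [of_add]
  simp only [Pi.add_apply, coeff_of]
  rw [iteratedDeriv_add hf₁.contDiffAt hf₂.contDiffAt, add_div]

theorem coeff_smul (c : ℂ) (g : HolGerm) : coeff (c • g) = c • coeff g := by
  obtain ⟨f, hf, rfl⟩ := exists_of g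
  funext n
  rw [smul_of]
  simp only [Pi.smul_apply, coeff_of, smul_eq_mul]
  rw [iteratedDeriv_const_smul hf.contDiffAt, smul_eq_mul, mul_div_assoc]

/-- The Taylor coefficients as a linear map. -/
def coeffLin : HolGerm →ₗ[ℂ] (ℕ → ℂ) where
  toFun := coeff
  map_add' := coeff_add
  map_smul' := coeff_smul

/-- The Cauchy estimates for elements of the disc algebra. -/
theorem norm_coeff_discToGerm_le {r : ℝ} (hr : 0 < r) (u : discAlgebra r) (n : ℕ) :
    ‖coeff (discToGerm r hr u) n‖ ≤ (2 / r) ^ n * ‖u‖ := by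
  obtain ⟨F, hF, hFu⟩ := u.2
  have hr2 : 0 < r / 2 := by positivity
  have heq : discExtend r u.1 =ᶠ[𝓝 0] F := by
    filter_upwards [Metric.closedBall_mem_nhds (0 : ℂ) hr] with z hz
    rw [discExtend_of_mem _ hz]
    exact (hFu ⟨z, hz⟩).symm
  have hd : DiffContOnCl ℂ F (Metric.ball 0 (r / 2)) := by
    refine (hF.mono ?_).diffContOnCl
    refine Metric.closure_ball_subset_closedBall.trans (Metric.closedBall_subset_ball ?_)
    linarith
  have hb : ∀ z ∈ Metric.sphere (0 : ℂ) (r / 2), ‖F z‖ ≤ ‖u‖ := by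
    intro z hz
    have hz' : z ∈ Metric.closedBall (0 : ℂ) r := by
      have h1 : dist z 0 = r / 2 := hz
      rw [Metric.mem_closedBall]
      linarith
    rw [hFu ⟨z, hz'⟩]
    exact ContinuousMap.norm_coe_le_norm u.1 _
  have h1 := Complex.norm_iteratedDeriv_le_of_forall_mem_sphere_norm_le n hr2 hd hb
  show ‖iteratedDeriv n (discExtend r u.1) 0 / (n.factorial : ℂ)‖ ≤ _
  rw [heq.iteratedDeriv_eq n, norm_div, Complex.norm_natCast,
    div_le_iff₀ (by exact_mod_cast n.factorial_pos)]
  refine h1.trans (le_of_eq ?_)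
  rw [div_pow, div_pow, div_div_eq_mul_div]
  ring

theorem continuous_coeff_discToGerm {r : ℝ} (hr : 0 < r) :
    Continuous fun u : discAlgebra r => coeff (discToGerm r hr u) := by
  refine continuous_pi fun n => ?_
  exact (LinearMap.mkContinuous
    ((LinearMap.proj n ∘ₗ coeffLin ∘ₗ discToGerm r hr : discAlgebra r →ₗ[ℂ] ℂ)) _
    fun u => norm_coeff_discToGerm_le hr u n).continuous

/-- `H₀` is a Hausdorff space. -/
instance : T2Space HolGerm := by
  have hmem : TopologicalSpace.induced coeffLin inferInstance ∈ stepTopologies := by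
    refine ⟨topologicalAddGroup_induced coeffLin, continuousSMul_induced coeffLin,
      LocallyConvexSpace.induced (coeffLin.restrictScalars ℝ), fun k => ?_⟩
    exact continuous_induced_rng.2 (continuous_coeff_discToGerm (stepRadius_pos k))
  have hc : Continuous (coeffLin : HolGerm → ℕ → ℂ) :=
    continuous_iff_le_induced.2 (sInf_le hmem)
  exact T2Space.of_injective_continuous coeff_injective hc

/-- The Taylor coefficients of a germ grow at most exponentially. -/
theorem coeff_bound (g : HolGerm) :
    ∃ r : ℝ, 0 < r ∧ r ≤ 1 ∧ ∃ M : ℝ, ∀ n, ‖coeff g n‖ * r ^ n ≤ M := by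
  obtain ⟨f, hf, rfl⟩ := exists_of g
  have h1 := hasFPowerSeriesAt_of f hf
  obtain ⟨r, hr0, hr⟩ := ENNReal.lt_iff_exists_nnreal_btwn.1 h1.radius_pos
  obtain ⟨M, -, hM⟩ := FormalMultilinearSeries.norm_mul_pow_le_of_lt_radius _ hr
  have hr0' : (0 : ℝ) < r := by exact_mod_cast hr0
  refine ⟨min r 1, lt_min hr0' one_pos, min_le_right _ _, M, fun n => le_trans ?_ (hM n)⟩
  rw [FormalMultilinearSeries.ofScalars_norm]
  gcongr
  exact min_le_left _ _

theorem cesaroSeq_bound {x : ℕ → ℂ} {r M : ℝ} (hr : 0 < r) (hr1 : r ≤ 1)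
    (hM : ∀ n, ‖x n‖ * r ^ n ≤ M) (n : ℕ) : ‖cesaroSeq x n‖ * r ^ n ≤ M := by
  have hn : (0 : ℝ) < (n : ℝ) + 1 := by positivity
  have h1 : ‖((n : ℂ) + 1)‖ = (n : ℝ) + 1 := by
    exact_mod_cast Complex.norm_natCast (n + 1)
  show ‖(∑ i ∈ Finset.range (n + 1), x i) / ((n : ℂ) + 1)‖ * r ^ n ≤ M
  rw [norm_div, h1, div_mul_eq_mul_div, div_le_iff₀ hn]
  calc ‖∑ i ∈ Finset.range (n + 1), x i‖ * r ^ n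
      ≤ (∑ i ∈ Finset.range (n + 1), ‖x i‖) * r ^ n := by
        gcongr; exact norm_sum_le _ _
    _ = ∑ i ∈ Finset.range (n + 1), ‖x i‖ * r ^ n := Finset.sum_mul _ _ _
    _ ≤ ∑ i ∈ Finset.range (n + 1), M := by
        refine Finset.sum_le_sum fun i hi => le_trans ?_ (hM i)
        gcongr ?_ * ?_
        exact pow_le_pow_of_le_one hr.le hr1 (Nat.lt_succ_iff.1 (Finset.mem_range.1 hi))
    _ = M * ((n : ℝ) + 1) := by simp [mul_comm]

theorem hasFPowerSeriesAt_tsum {x : ℕ → ℂ} {r M : ℝ} (hr : 0 < r)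
    (hM : ∀ n, ‖x n‖ * r ^ n ≤ M) :
    HasFPowerSeriesAt (fun z : ℂ => ∑' n, x n * z ^ n)
      (FormalMultilinearSeries.ofScalars ℂ x) 0 := by
  obtain ⟨s, rfl⟩ : ∃ s : NNReal, (s : ℝ) = r := ⟨⟨r, hr.le⟩, rfl⟩
  have h1 : (s : ENNReal) ≤ (FormalMultilinearSeries.ofScalars ℂ x).radius :=
    FormalMultilinearSeries.le_radius_of_bound _ M fun n => by
      rw [FormalMultilinearSeries.ofScalars_norm]
      exact hM n
  have h2 : 0 < (FormalMultilinearSeries.ofScalars ℂ x).radius :=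
    lt_of_lt_of_le (by exact_mod_cast hr) h1
  have h3 := (FormalMultilinearSeries.hasFPowerSeriesOnBall _ h2).hasFPowerSeriesAt
  have h4 := FormalMultilinearSeries.ofScalarsSum_eq_tsum (E := ℂ) x
  rw [FormalMultilinearSeries.ofScalarsSum] at h4
  rw [h4] at h3
  exact h3

theorem cesaro_hasFPowerSeriesAt (g : HolGerm) :
    HasFPowerSeriesAt (fun z : ℂ => ∑' n, cesaroSeq (coeff g) n * z ^ n)
      (FormalMultilinearSeries.ofScalars ℂ (cesaroSeq (coeff g))) 0 := by
  obtain ⟨r, hr, hr1, M, hM⟩ := coeff_bound g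
  exact hasFPowerSeriesAt_tsum hr (cesaroSeq_bound hr hr1 hM)

/-- The germ whose Taylor coefficients are the Cesàro means of the Taylor coefficients of `g`. -/
def cesaroFun (g : HolGerm) : HolGerm :=
  of (fun z : ℂ => ∑' n, cesaroSeq (coeff g) n * z ^ n) (cesaro_hasFPowerSeriesAt g).analyticAt

theorem coeff_cesaroFun (g : HolGerm) : coeff (cesaroFun g) = cesaroSeq (coeff g) := by
  have h1 := hasFPowerSeriesAt_of _ (cesaro_hasFPowerSeriesAt g).analyticAt
  exact FormalMultilinearSeries.ofScalars_series_injective ℂ ℂ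
    (h1.eq_formalMultilinearSeries (cesaro_hasFPowerSeriesAt g))

/-- The Cesàro operator on `H₀`: it sends the germ of `∑ aₙ zⁿ` to the germ of
`∑ ((a₀ + ⋯ + aₙ) / (n + 1)) zⁿ`. -/
def cesaro : HolGerm →ₗ[ℂ] HolGerm where
  toFun := cesaroFun
  map_add' g h := coeff_injective <| by
    rw [coeff_cesaroFun, coeff_add, coeff_add, coeff_cesaroFun, coeff_cesaroFun, map_add]
  map_smul' c g := coeff_injective <| by
    rw [RingHom.id_apply, coeff_cesaroFun, coeff_smul, coeff_smul, coeff_cesaroFun, map_smul]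

theorem coeff_cesaro (g : HolGerm) (n : ℕ) :
    coeff (cesaro g) n = (∑ i ∈ Finset.range (n + 1), coeff g i) / ((n : ℂ) + 1) :=
  congrFun (coeff_cesaroFun g) n

end HolGerm

/-! ## Spectra and compactness of operators on locally convex spaces

For `T : E →L[ℂ] E`, `spectrum ℂ T` is the set of all `μ` for which `μ I - T` has no inverse in the
algebra `E →L[ℂ] E` of continuous linear operators. -/

section Operators

variable {E : Type*} [AddCommGroup E] [Module ℂ E] [TopologicalSpace E]

/-- The point spectrum: all `μ` for which `μ I - T` is not injective. -/
def pointSpectrum (T : E →L[ℂ] E) : Set ℂ :=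
  {μ | ¬ Function.Injective fun x : E => μ • x - T x}

/-- The set `ρ*(T)`: all `μ` for which some open disc around `μ` lies in the resolvent set and has
an equicontinuous family of resolvents. -/
def resolventSetStar [IsTopologicalAddGroup E] [ContinuousConstSMul ℂ E] (T : E →L[ℂ] E) : Set ℂ :=
  {μ | ∃ δ : ℝ, 0 < δ ∧ Metric.ball μ δ ⊆ resolventSet ℂ T ∧
    letI : UniformSpace E := IsTopologicalAddGroup.rightUniformSpace E
    Equicontinuous fun (ν : Metric.ball μ δ) (x : E) => resolvent T (ν : ℂ) x}

/-- The set `σ*(T)`, the complement of `ρ*(T)`. -/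
def spectrumStar [IsTopologicalAddGroup E] [ContinuousConstSMul ℂ E] (T : E →L[ℂ] E) : Set ℂ :=
  (resolventSetStar T)ᶜ

/-- An operator is weakly compact if it maps some neighbourhood of `0` (for the original topology)
into a set that is compact for the weak topology. -/
def IsWeaklyCompactOperator (T : E →L[ℂ] E) : Prop :=
  IsCompactOperator fun x : E => toWeakSpace ℂ E (T x)

end Operators

end

open Filter Topology Set

noncomputable section

/-! ### Topology of `HolGerm` through geometric bounds on Taylor coefficients -/

namespace HolGerm

/-! The topology is handled through bounds `‖aₙ‖ ≤ A * R ^ n`. Cauchy estimates and summation of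
power series translate between such bounds and norms in the steps, at the price of changing `R`.
Hence an operator is continuous once it takes each rate `R` to some rate `R'` with a linear loss in
`A`, and a family is equicontinuous if this holds uniformly (`equicontinuous_of_coeffBound`).

On coefficients, `C` is lower triangular with diagonal entries `1 / (n + 1)`. Off the diagonal
values and `0`, forward substitution solves the resolvent equation, with geometric bounds depending
only on the distance `d` to the diagonal; a whole disc shares one `d`, which gives `ρ*`. At `0` the
inverse is explicit and loses only a factor of order `n`, absorbed by a larger rate, so `C` is
invertible. The eigenvectors are the binomial columns `j.choose n`, of growth at most `2 ^ j`. As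
the eigenvalues accumulate at `0`, that point lies in `σ*` though not in `σ`.

Since `C` is invertible, weak compactness would give a neighbourhood of `0` on which every
functional is bounded. `exists_functional_unbounded` excludes this, by a functional with coefficient
weights decaying faster than every geometric rate. -/

/-- The Taylor coefficients of `g` are dominated by the geometric sequence `A * R ^ n`. -/
def CoeffBound (g : HolGerm) (A R : ℝ) : Prop := ∀ n, ‖coeff g n‖ ≤ A * R ^ n

theorem CoeffBound.nonneg {g : HolGerm} {A R : ℝ} (h : CoeffBound g A R) : 0 ≤ A := by
  simpa using (norm_nonneg _).trans (h 0)

theorem coeff_eq_of_hasFPowerSeriesAt {f : ℂ → ℂ} (hf : AnalyticAt ℂ f 0) {x : ℕ → ℂ}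
    (h : HasFPowerSeriesAt f (FormalMultilinearSeries.ofScalars ℂ x) 0) :
    coeff (of f hf) = x :=
  FormalMultilinearSeries.ofScalars_series_injective ℂ ℂ
    ((hasFPowerSeriesAt_of f hf).eq_formalMultilinearSeries h)

theorem hasFPowerSeriesAt_tsum_of_le {x : ℕ → ℂ} {A R : ℝ} (hR : 0 < R)
    (hx : ∀ n, ‖x n‖ ≤ A * R ^ n) :
    HasFPowerSeriesAt (fun z : ℂ => ∑' n, x n * z ^ n)
      (FormalMultilinearSeries.ofScalars ℂ x) 0 := by
  refine hasFPowerSeriesAt_tsum (M := A) (inv_pos.2 hR) fun n => ?_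
  rw [inv_pow]
  exact mul_inv_le_of_le_mul₀ (by positivity) (by simpa using (norm_nonneg _).trans (hx 0)) (hx n)

theorem exists_coeff_eq {x : ℕ → ℂ} {A R : ℝ} (hR : 0 < R) (hx : ∀ n, ‖x n‖ ≤ A * R ^ n) :
    ∃ g, coeff g = x :=
  ⟨of _ (hasFPowerSeriesAt_tsum_of_le hR hx).analyticAt,
    coeff_eq_of_hasFPowerSeriesAt _ (hasFPowerSeriesAt_tsum_of_le hR hx)⟩

theorem exists_coeffBound (g : HolGerm) : ∃ A R : ℝ, 1 ≤ R ∧ CoeffBound g A R := by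
  obtain ⟨r, hr, hr1, M, hM⟩ := coeff_bound g
  refine ⟨M, r⁻¹, (one_le_inv₀ hr).2 hr1, fun n => ?_⟩
  rw [inv_pow, ← div_eq_mul_inv, le_div_iff₀ (by positivity)]
  exact hM n

theorem exists_stepRadius_mul_le (R : ℝ) : ∃ k, stepRadius k * R ≤ 1 / 4 := by
  obtain ⟨k, hk⟩ := exists_nat_ge (4 * R)
  refine ⟨k, ?_⟩
  rw [stepRadius, div_mul_eq_mul_div, div_le_div_iff₀ (by positivity) (by norm_num)]
  linarith

/-- On the larger disc of radius `2 * r` the terms are at most `A * (2 * r * R) ^ n ≤ A / 2 ^ n`. So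
the series is holomorphic past the closed disc of radius `r`, with supremum at most `2 * A`. -/
theorem CoeffBound.exists_discToGerm {g : HolGerm} {A R r : ℝ} (hg : CoeffBound g A R)
    (hR : 0 < R) (hr : 0 < r) (hrR : r * R ≤ 1 / 4) :
    ∃ u : discAlgebra r, discToGerm r hr u = g ∧ ‖u‖ ≤ 2 * A := by
  have hA := hg.nonneg
  set F : ℂ → ℂ := fun z => ∑' n, coeff g n * z ^ n
  have hsum : Summable fun n : ℕ => A * (1 / 2 : ℝ) ^ n :=
    (summable_geometric_of_lt_one (by norm_num) (by norm_num)).mul_left A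
  have hterm : ∀ n : ℕ, ∀ z ∈ Metric.ball (0 : ℂ) (2 * r),
      ‖coeff g n * z ^ n‖ ≤ A * (1 / 2) ^ n := by
    intro n z hz
    rw [mem_ball_zero_iff] at hz
    rw [norm_mul, norm_pow]
    calc ‖coeff g n‖ * ‖z‖ ^ n ≤ (A * R ^ n) * (2 * r) ^ n := by
          gcongr
          exact hg n
      _ = A * (2 * (r * R)) ^ n := by rw [mul_assoc, ← mul_pow]; ring_nf
      _ ≤ A * (1 / 2) ^ n := by
          gcongr
          linarith
  have hd : DifferentiableOn ℂ F (Metric.ball 0 (2 * r)) :=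
    Complex.differentiableOn_tsum_of_summable_norm hsum
      (fun n => (by fun_prop : Differentiable ℂ fun z : ℂ => coeff g n * z ^ n).differentiableOn)
      Metric.isOpen_ball hterm
  have hsub : Metric.closedBall (0 : ℂ) r ⊆ Metric.ball 0 (2 * r) :=
    Metric.closedBall_subset_ball (by linarith)
  have hnorm : ∀ z ∈ Metric.closedBall (0 : ℂ) r, ‖F z‖ ≤ 2 * A := by
    intro z hz
    refine (tsum_of_norm_bounded (hsum.hasSum) fun n => hterm n z (hsub hz)).trans (le_of_eq ?_)
    rw [tsum_mul_left, tsum_geometric_two, mul_comm]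
  let u : C(Metric.closedBall (0 : ℂ) r, ℂ) :=
    ⟨fun z => F z, (hd.continuousOn.mono hsub).domRestrict⟩
  have hu : u ∈ discAlgebra r :=
    ⟨F, hd.mono (Metric.ball_subset_ball (by linarith)), fun z => rfl⟩
  have hps := hasFPowerSeriesAt_tsum_of_le hR hg
  refine ⟨⟨u, hu⟩, coeff_injective ?_, ?_⟩
  · rw [← coeff_eq_of_hasFPowerSeriesAt hps.analyticAt hps]
    congr 1
    refine (of_eq_of (hf := discExtend_analyticAt hr ⟨u, hu⟩)).2 ?_
    filter_upwards [Metric.closedBall_mem_nhds (0 : ℂ) hr] with z hz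
    rw [discExtend_of_mem _ hz]
    rfl
  · exact (ContinuousMap.norm_le u (by positivity)).2 fun z => hnorm z z.2

/-- A continuous seminorm on `H₀` is controlled by geometric bounds on the coefficients. -/
theorem exists_seminorm_le {p : Seminorm ℂ HolGerm} (hp : Continuous p) {R : ℝ} (hR : 0 < R) :
    ∃ B, 0 ≤ B ∧ ∀ g A, CoeffBound g A R → p g ≤ B * A := by
  obtain ⟨k, hk⟩ := exists_stepRadius_mul_le R
  obtain ⟨B, hB, h⟩ := Seminorm.bound_of_continuous_normedSpace
    (p.comp (discToGerm (stepRadius k) (stepRadius_pos k)))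
    (hp.comp (continuous_discToGerm k))
  refine ⟨B * 2, by positivity, fun g A hg => ?_⟩
  obtain ⟨u, rfl, hu⟩ := hg.exists_discToGerm hR (stepRadius_pos k) hk
  calc p _ ≤ B * ‖u‖ := h u
    _ ≤ B * (2 * A) := by gcongr
    _ = B * 2 * A := by ring

theorem coeffBound_discToGerm {r : ℝ} (hr : 0 < r) (u : discAlgebra r) :
    CoeffBound (discToGerm r hr u) ‖u‖ (2 / r) := fun n => by
  rw [mul_comm]
  exact norm_coeff_discToGerm_le hr u n

theorem stepRadius_le_one (k : ℕ) : stepRadius k ≤ 1 := by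
  rw [stepRadius, div_le_one (by positivity)]
  linarith [k.cast_nonneg (α := ℝ)]

theorem exists_topology_of_seminorm {E : Type*} [AddCommGroup E] [Module ℂ E]
    (p : Seminorm ℂ E) : ∃ t : TopologicalSpace E, @WithSeminorms ℂ E Unit _ _ _ (fun _ => p) t :=
  letI t := (SeminormFamily.moduleFilterBasis fun _ : Unit => p).topology
  ⟨t, ⟨rfl⟩⟩

theorem _root_.WithSeminorms.continuous_of_le_mul_norm {E F : Type*} [SeminormedAddCommGroup E]
    [NormedSpace ℂ E] [AddCommGroup F] [Module ℂ F] [TopologicalSpace F] {p : Seminorm ℂ F}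
    (hp : WithSeminorms fun _ : Unit => p) (f : E →ₗ[ℂ] F) {B : ℝ} (h : ∀ x, p (f x) ≤ B * ‖x‖) :
    Continuous f := by
  refine hp.continuous_normedSpace_dom E f fun _ => ⟨B.toNNReal, fun x => ?_⟩
  refine (h x).trans ?_
  change B * ‖x‖ ≤ (B.toNNReal : ℝ) * ‖x‖
  gcongr
  exact Real.le_coe_toNNReal B

/-- A seminorm on `H₀` which is controlled by geometric bounds on the coefficients is
continuous. -/
theorem continuous_seminorm_of_le {p : Seminorm ℂ HolGerm}
    (h : ∀ R : ℝ, 1 ≤ R → ∃ B, ∀ g A, CoeffBound g A R → p g ≤ B * A) : Continuous p := by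
  obtain ⟨t, ht⟩ := exists_topology_of_seminorm p
  -- The topology of `p` alone competes in the infimum, so the inductive limit topology is finer and
  -- keeps `p` continuous.
  have hmem : t ∈ stepTopologies := by
    refine ⟨@WithSeminorms.topologicalAddGroup _ _ _ _ _ _ t _ ht,
      @WithSeminorms.continuousSMul _ _ _ _ _ _ t _ ht,
      @WithSeminorms.toLocallyConvexSpace _ _ _ _ _ _ _ _ _ t _ ht, fun k => ?_⟩
    obtain ⟨B, hB⟩ := h (2 / stepRadius k) <| by
      rw [le_div_iff₀ (stepRadius_pos k)]
      linarith [stepRadius_le_one k]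
    exact @WithSeminorms.continuous_of_le_mul_norm _ _ _ _ _ _ t _ ht _ B fun u =>
      hB _ _ (coeffBound_discToGerm (stepRadius_pos k) u)
  have hp : @Continuous _ _ t _ p := @WithSeminorms.continuous_seminorm _ _ _ _ _ _ t _ ht ()
  exact continuous_le_dom (sInf_le hmem) hp

instance : ContinuousSMul ℝ HolGerm := IsScalarTower.continuousSMul ℂ

open scoped ComplexOrder in
-- Nonnegative complex scalars are the nonnegative reals, so real convexity is already complex
-- convexity.
instance : LocallyConvexSpace ℂ HolGerm :=
  .ofBasisZero ℂ HolGerm id _ (LocallyConvexSpace.convex_basis_zero ℝ HolGerm) fun _ hs =>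
    convex_of_nonneg_surjective_algebraMap _
      (fun _ h => (RCLike.nonneg_iff_exists_ofReal (K := ℂ)).1 h) hs.2

/-- A family of linear maps on `H₀` satisfying uniform coefficient estimates is equicontinuous. -/
theorem equicontinuous_of_coeffBound {ι : Type*} (T : ι → HolGerm →ₗ[ℂ] HolGerm)
    (h : ∀ R : ℝ, 1 ≤ R → ∃ R' M : ℝ, 0 < R' ∧ ∀ i g A, CoeffBound g A R →
      CoeffBound (T i g) (M * A) R') :
    letI : UniformSpace HolGerm := IsTopologicalAddGroup.rightUniformSpace HolGerm
    Equicontinuous fun i (g : HolGerm) => T i g := by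
  let : UniformSpace HolGerm := IsTopologicalAddGroup.rightUniformSpace HolGerm
  have : IsUniformAddGroup HolGerm := isUniformAddGroup_of_addCommGroup
  -- Equicontinuity reduces to this: for each continuous seminorm `p`, the supremum of the `p ∘ T i`
  -- is finite and continuous.
  refine ((PolynormableSpace.withSeminorms ℂ HolGerm).equicontinuous_TFAE T).out 4 1 |>.1 ?_
  rintro ⟨p, hp⟩
  have key : ∀ R : ℝ, 1 ≤ R → ∃ B, 0 ≤ B ∧ ∀ i g A, CoeffBound g A R → p (T i g) ≤ B * A := by
    intro R hR
    obtain ⟨R', M, hR', hT⟩ := h R hR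
    obtain ⟨B, hB, hBp⟩ := exists_seminorm_le hp hR'
    refine ⟨B * |M|, by positivity, fun i g A hg => ?_⟩
    refine (hBp _ _ (hT i g A hg)).trans ?_
    rw [mul_assoc]
    have := hg.nonneg
    gcongr
    exact le_abs_self M
  have hbdd : BddAbove (range fun i => p.comp (T i)) := by
    rw [Seminorm.bddAbove_range_iff]
    intro g
    obtain ⟨A, R, hR, hg⟩ := exists_coeffBound g
    obtain ⟨B, -, hB⟩ := key R hR
    exact ⟨B * A, by rintro _ ⟨i, rfl⟩; exact hB i g A hg⟩
  refine ⟨hbdd, ?_⟩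
  rw [← Seminorm.coe_iSup_eq hbdd]
  refine continuous_seminorm_of_le fun R hR => ?_
  obtain ⟨B, hB0, hB⟩ := key R hR
  refine ⟨B, fun g A hg => ?_⟩
  rw [Seminorm.iSup_apply hbdd]
  exact Real.iSup_le (fun i => hB i g A hg) (mul_nonneg hB0 hg.nonneg)

theorem continuous_of_coeffBound (T : HolGerm →ₗ[ℂ] HolGerm)
    (h : ∀ R : ℝ, 1 ≤ R → ∃ R' M : ℝ, 0 < R' ∧ ∀ g A, CoeffBound g A R →
      CoeffBound (T g) (M * A) R') : Continuous T := by
  let : UniformSpace HolGerm := IsTopologicalAddGroup.rightUniformSpace HolGerm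
  refine Equicontinuous.continuous (equicontinuous_of_coeffBound (fun _ : Unit => T) ?_) ()
  intro R hR
  obtain ⟨R', M, hR', hT⟩ := h R hR
  exact ⟨R', M, hR', fun _ => hT⟩

theorem continuous_functional_of_coeffBound (φ : HolGerm →ₗ[ℂ] ℂ)
    (h : ∀ R : ℝ, 1 ≤ R → ∃ B, ∀ g A, CoeffBound g A R → ‖φ g‖ ≤ B * A) : Continuous φ :=
  (norm_withSeminorms ℂ ℂ).continuous_of_continuous_comp φ fun _ =>
    continuous_seminorm_of_le h

end HolGerm

/-! ### The resolvent equation and the eigenvectors on sequences -/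

/-- Isolating the diagonal term turns the resolvent equation into a recursion for `x n`. -/
theorem mul_sub_cesaroSeq (x : ℕ → ℂ) (μ : ℂ) (n : ℕ) :
    μ * x n - cesaroSeq x n =
      (μ - 1 / ((n : ℂ) + 1)) * x n - (∑ i ∈ Finset.range n, x i) / ((n : ℂ) + 1) := by
  change μ * x n - (∑ i ∈ Finset.range (n + 1), x i) / ((n : ℂ) + 1) = _
  rw [Finset.sum_range_succ]
  ring

theorem norm_natCast_add_one (n : ℕ) : ‖(n : ℂ) + 1‖ = (n : ℝ) + 1 := by
  exact_mod_cast Complex.norm_natCast (n + 1)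

theorem norm_cesaroSeq_le {x : ℕ → ℂ} {A R : ℝ} (hR : 1 ≤ R) (hx : ∀ n, ‖x n‖ ≤ A * R ^ n)
    (n : ℕ) : ‖cesaroSeq x n‖ ≤ A * R ^ n := by
  have hA : 0 ≤ A := by simpa using (norm_nonneg _).trans (hx 0)
  change ‖(∑ i ∈ Finset.range (n + 1), x i) / ((n : ℂ) + 1)‖ ≤ _
  rw [norm_div, norm_natCast_add_one, div_le_iff₀ (by positivity)]
  calc ‖∑ i ∈ Finset.range (n + 1), x i‖ ≤ ∑ i ∈ Finset.range (n + 1), A * R ^ n := by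
        refine norm_sum_le_of_le _ fun i hi => (hx i).trans ?_
        gcongr
        exact Nat.lt_succ_iff.1 (Finset.mem_range.1 hi)
    _ = A * R ^ n * (n + 1) := by simp [mul_comm]

/-- Off the points `1 / (n + 1)`, the resolvent equation of the Cesàro operator is solvable in the
space of all sequences. -/
theorem exists_mul_sub_cesaroSeq_eq {μ : ℂ} (hμ : ∀ n : ℕ, μ ≠ 1 / ((n : ℂ) + 1)) (y : ℕ → ℂ) :
    ∃ x : ℕ → ℂ, ∀ n, μ * x n - cesaroSeq x n = y n := by
  -- `S n` is the sum of the first `n` terms of the solution; recursing on it avoids a strong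
  -- recursion.
  let S : ℕ → ℂ := fun n => Nat.rec 0
    (fun n s => s + (y n + s / ((n : ℂ) + 1)) / (μ - 1 / ((n : ℂ) + 1))) n
  let x : ℕ → ℂ := fun n => (y n + S n / ((n : ℂ) + 1)) / (μ - 1 / ((n : ℂ) + 1))
  have hS : ∀ n, ∑ i ∈ Finset.range n, x i = S n := by
    intro n
    induction n with
    | zero => rfl
    | succ n ih => rw [Finset.sum_range_succ, ih]
  refine ⟨x, fun n => ?_⟩
  rw [mul_sub_cesaroSeq, hS, mul_div_cancel₀ _ (sub_ne_zero.2 (hμ n)), add_sub_cancel_right]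

/-- The recursion gives `d * ‖x n‖ ≤ ‖y n‖ + ∑ i < n, ‖x i‖`. The rate `S = R + 2 / d` satisfies `S
- 1 ≥ 2 / d`, so the geometric sum closes a strong induction. Only `d` enters, which makes the bound
uniform in `μ`. -/
theorem norm_le_of_mul_sub_cesaroSeq_eq {μ : ℂ} {d : ℝ} (hd : 0 < d)
    (hμ : ∀ n : ℕ, d ≤ ‖μ - 1 / ((n : ℂ) + 1)‖) {x y : ℕ → ℂ} {A R : ℝ} (hR : 1 ≤ R)
    (hxy : ∀ n, μ * x n - cesaroSeq x n = y n) (hy : ∀ n, ‖y n‖ ≤ A * R ^ n) (n : ℕ) :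
    ‖x n‖ ≤ 2 / d * A * (R + 2 / d) ^ n := by
  have hA : 0 ≤ A := by simpa using (norm_nonneg _).trans (hy 0)
  have hd2 : 0 < 2 / d := by positivity
  set S := R + 2 / d with hS
  have hgeom : 2 / d * ∑ i ∈ Finset.range n, S ^ i ≤ S ^ n := by
    have h1 := geom_sum_mul S n
    have h2 : 0 ≤ ∑ i ∈ Finset.range n, S ^ i := Finset.sum_nonneg fun i _ => by positivity
    nlinarith
  induction n using Nat.strong_induction_on with
  | _ n ih =>
    have ih' : ∀ i ∈ Finset.range n, ‖x i‖ ≤ 2 / d * A * S ^ i := by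
      intro i hi
      -- `hgeom` mentions `n`, so it is a premise of the induction hypothesis.
      refine ih i (Finset.mem_range.1 hi) ?_
      have h1 := geom_sum_mul S i
      have h2 : 0 ≤ ∑ i ∈ Finset.range i, S ^ i := Finset.sum_nonneg fun i _ => by positivity
      nlinarith
    have hsum : ‖(∑ i ∈ Finset.range n, x i) / ((n : ℂ) + 1)‖ ≤ A * S ^ n := by
      rw [norm_div, norm_natCast_add_one]
      refine (div_le_self (norm_nonneg _) (by linarith [n.cast_nonneg (α := ℝ)])).trans ?_
      calc _ ≤ ∑ i ∈ Finset.range n, 2 / d * A * S ^ i := norm_sum_le_of_le _ ih'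
        _ = A * (2 / d * ∑ i ∈ Finset.range n, S ^ i) := by rw [← Finset.mul_sum]; ring
        _ ≤ A * S ^ n := by gcongr
    have heq : (μ - 1 / ((n : ℂ) + 1)) * x n =
        y n + (∑ i ∈ Finset.range n, x i) / ((n : ℂ) + 1) := by
      rw [← hxy n, mul_sub_cesaroSeq, sub_add_cancel]
    have hyS : ‖y n‖ ≤ A * S ^ n := by
      refine (hy n).trans ?_
      gcongr
      linarith
    have hle : d * ‖x n‖ ≤ A * S ^ n + A * S ^ n :=
      calc d * ‖x n‖ ≤ ‖μ - 1 / ((n : ℂ) + 1)‖ * ‖x n‖ := by gcongr; exact hμ n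
        _ = ‖y n + (∑ i ∈ Finset.range n, x i) / ((n : ℂ) + 1)‖ := by rw [← norm_mul, heq]
        _ ≤ _ := (norm_add_le _ _).trans (add_le_add hyS hsum)
    rw [div_mul_eq_mul_div, div_mul_eq_mul_div, le_div_iff₀ hd]
    linarith

/-- The diagonal accumulates at `0`, so no `d` exists. Instead the partial sums of `x` are `-(n + 1)
* y n`, `x` is their difference, and `n + 1 ≤ 2 ^ n`. -/
theorem norm_le_of_neg_cesaroSeq_eq {x y : ℕ → ℂ} {A R : ℝ} (hR : 1 ≤ R)
    (hxy : ∀ n, (0 : ℂ) * x n - cesaroSeq x n = y n) (hy : ∀ n, ‖y n‖ ≤ A * R ^ n) (n : ℕ) :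
    ‖x n‖ ≤ 2 * A * (2 * R) ^ n := by
  have hA : 0 ≤ A := by simpa using (norm_nonneg _).trans (hy 0)
  have hsum : ∀ n, ∑ i ∈ Finset.range (n + 1), x i = -((n : ℂ) + 1) * y n := by
    intro n
    have hn : (n : ℂ) + 1 ≠ 0 := by exact_mod_cast n.succ_ne_zero
    rw [← hxy n]
    change _ = -((n : ℂ) + 1) * (0 * x n - (∑ i ∈ Finset.range (n + 1), x i) / ((n : ℂ) + 1))
    field_simp
    ring
  have hle : ∀ n, ‖∑ i ∈ Finset.range (n + 1), x i‖ ≤ ((n : ℝ) + 1) * (A * R ^ n) := by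
    intro n
    rw [hsum, norm_mul, norm_neg, norm_natCast_add_one]
    gcongr
    exact hy n
  have hle' : ‖∑ i ∈ Finset.range n, x i‖ ≤ ((n : ℝ) + 1) * (A * R ^ n) := by
    cases n with
    | zero => simpa using hA
    | succ n =>
      refine (hle n).trans ?_
      push_cast
      gcongr
      · linarith
      · exact n.le_succ
  have hn : (n : ℝ) + 1 ≤ 2 ^ n := by exact_mod_cast Nat.lt_two_pow_self
  have hx : x n = ∑ i ∈ Finset.range (n + 1), x i - ∑ i ∈ Finset.range n, x i := by
    rw [Finset.sum_range_succ]; ring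
  calc ‖x n‖ ≤ ((n : ℝ) + 1) * (A * R ^ n) + ((n : ℝ) + 1) * (A * R ^ n) := by
        rw [hx]; exact (norm_sub_le _ _).trans (add_le_add (hle n) hle')
    _ = 2 * A * (((n : ℝ) + 1) * R ^ n) := by ring
    _ ≤ 2 * A * (2 ^ n * R ^ n) := by gcongr
    _ = 2 * A * (2 * R) ^ n := by rw [mul_pow]

/-- The hockey-stick identity, followed by absorption in `(n + 1).choose (m + 1)`. -/
theorem cesaroSeq_choose (m n : ℕ) :
    cesaroSeq (fun j => (j.choose m : ℂ)) n = 1 / ((m : ℂ) + 1) * (n.choose m : ℂ) := by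
  change (∑ j ∈ Finset.range (n + 1), (j.choose m : ℂ)) / ((n : ℂ) + 1) = _
  have hn : (n : ℂ) + 1 ≠ 0 := by exact_mod_cast n.succ_ne_zero
  have hm : (m : ℂ) + 1 ≠ 0 := by exact_mod_cast m.succ_ne_zero
  have h1 : ∑ j ∈ Finset.range (n + 1), j.choose m = (n + 1).choose (m + 1) := by
    rw [← Nat.sum_Icc_choose, Finset.range_eq_Ico]
    refine (Finset.sum_subset (fun i hi => ?_) fun i _ hi' => Nat.choose_eq_zero_of_lt ?_).symm
    · simp at hi ⊢; omega
    · simp at *; omega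
  have h2 : ((n : ℂ) + 1) * (n.choose m : ℂ) = ((n + 1).choose (m + 1) : ℂ) * ((m : ℂ) + 1) := by
    exact_mod_cast Nat.add_one_mul_choose_eq n m
  have h3 : ∑ j ∈ Finset.range (n + 1), (j.choose m : ℂ) = ((n + 1).choose (m + 1) : ℂ) := by
    exact_mod_cast h1
  rw [h3]
  field_simp
  rw [h2]

/-! ### Continuity and spectra of the Cesàro operator -/

namespace HolGerm

theorem continuous_cesaro : Continuous cesaro :=
  continuous_of_coeffBound cesaro fun R hR =>
    ⟨R, 1, by linarith, fun g A hg n => by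
      rw [one_mul]
      change ‖coeff (cesaroFun g) n‖ ≤ _
      rw [coeff_cesaroFun]
      exact norm_cesaroSeq_le hR hg n⟩

/-- The Cesàro operator as a continuous linear operator on `H₀`. -/
def cesaroCLM : HolGerm →L[ℂ] HolGerm := ⟨cesaro, continuous_cesaro⟩

theorem coeff_smul_sub_cesaroCLM (μ : ℂ) (g : HolGerm) (n : ℕ) :
    coeff (μ • g - cesaroCLM g) n = μ * coeff g n - cesaroSeq (coeff g) n := by
  change coeffLin (μ • g - cesaroFun g) n = _
  rw [map_sub, map_smul]
  change μ * coeff g n - coeff (cesaroFun g) n = _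
  rw [coeff_cesaroFun]

theorem algebraMap_sub_apply (T : HolGerm →L[ℂ] HolGerm) (μ : ℂ) (g : HolGerm) :
    (algebraMap ℂ (HolGerm →L[ℂ] HolGerm) μ - T) g = μ • g - T g := by
  simp [Algebra.algebraMap_eq_smul_one]

/-- The a priori estimate is exactly the continuity of the algebraic inverse, so no open mapping
theorem is needed. -/
theorem isUnit_of_coeffBound (T : HolGerm →L[ℂ] HolGerm)
    (hsurj : ∀ R : ℝ, 1 ≤ R → ∃ R' M : ℝ, 0 < R' ∧
      ∀ g A, CoeffBound (T g) A R → CoeffBound g (M * A) R')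
    (h : Function.Bijective T) : IsUnit T := by
  let e := LinearEquiv.ofBijective (T : HolGerm →ₗ[ℂ] HolGerm) h
  have he : ∀ g, T (e.symm g) = g := e.apply_symm_apply
  have he' : ∀ g, e.symm (T g) = g := e.symm_apply_apply
  let S : HolGerm →L[ℂ] HolGerm := ⟨e.symm, continuous_of_coeffBound _ fun R hR => by
    obtain ⟨R', M, hR', hM⟩ := hsurj R hR
    exact ⟨R', M, hR', fun g A hg => hM _ A (by simpa [he] using hg)⟩⟩
  exact ⟨⟨T, S, ContinuousLinearMap.ext he, ContinuousLinearMap.ext he'⟩, rfl⟩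

/-- The estimate `hb` serves three times: for continuity of the inverse, for injectivity (with `A =
0`), and to show that the formal solution is a germ. -/
theorem isUnit_algebraMap_sub_cesaroCLM {μ : ℂ} (hμ : ∀ n : ℕ, μ ≠ 1 / ((n : ℂ) + 1))
    (hb : ∀ R : ℝ, 1 ≤ R → ∃ R' M : ℝ, 0 < R' ∧ ∀ (x y : ℕ → ℂ) (A : ℝ),
      (∀ n, μ * x n - cesaroSeq x n = y n) → (∀ n, ‖y n‖ ≤ A * R ^ n) →
        ∀ n, ‖x n‖ ≤ M * A * R' ^ n) :
    IsUnit (algebraMap ℂ (HolGerm →L[ℂ] HolGerm) μ - cesaroCLM) := by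
  refine isUnit_of_coeffBound _ (fun R hR => ?_) ⟨?_, fun y => ?_⟩
  · obtain ⟨R', M, hR', h⟩ := hb R hR
    refine ⟨R', M, hR', fun g A hg => h _ _ A (fun n => rfl) fun n => ?_⟩
    rw [← coeff_smul_sub_cesaroCLM, ← algebraMap_sub_apply]
    exact hg n
  · rw [injective_iff_map_eq_zero]
    intro g hg
    obtain ⟨R', M, hR', h⟩ := hb 1 le_rfl
    have h0 : ∀ n, coeff g n = 0 := fun n => by
      simpa using h (coeff g) 0 0 (fun n => by
        rw [← coeff_smul_sub_cesaroCLM, ← algebraMap_sub_apply, hg]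
        exact congrFun (map_zero coeffLin) n) (by simp) n
    exact coeff_injective ((funext h0).trans (map_zero coeffLin).symm)
  · obtain ⟨A, R, hR, hy⟩ := exists_coeffBound y
    obtain ⟨R', M, hR', h⟩ := hb R hR
    obtain ⟨x, hx⟩ := exists_mul_sub_cesaroSeq_eq hμ (coeff y)
    obtain ⟨g, rfl⟩ := exists_coeff_eq hR' (h x _ A hx hy)
    refine ⟨g, coeff_injective (funext fun n => ?_)⟩
    rw [algebraMap_sub_apply, coeff_smul_sub_cesaroCLM, hx]

theorem zero_mem_resolventSet_cesaroCLM : (0 : ℂ) ∈ resolventSet ℂ cesaroCLM := by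
  refine isUnit_algebraMap_sub_cesaroCLM (fun n h => ?_) fun R hR =>
    ⟨2 * R, 2, by linarith, fun x y A hxy hy => norm_le_of_neg_cesaroSeq_eq hR hxy hy⟩
  have : (n : ℂ) + 1 ≠ 0 := by exact_mod_cast n.succ_ne_zero
  exact (one_div_ne_zero this) h.symm

theorem mem_resolventSet_cesaroCLM {μ : ℂ} {d : ℝ} (hd : 0 < d)
    (hμ : ∀ n : ℕ, d ≤ ‖μ - 1 / ((n : ℂ) + 1)‖) : μ ∈ resolventSet ℂ cesaroCLM := by
  refine isUnit_algebraMap_sub_cesaroCLM (fun n h => ?_) fun R hR =>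
    ⟨R + 2 / d, 2 / d, by positivity, fun x y A hxy hy =>
      norm_le_of_mul_sub_cesaroSeq_eq hd hμ hR hxy hy⟩
  have := hμ n
  rw [h, sub_self, norm_zero] at this
  linarith

theorem smul_resolvent_sub {T : HolGerm →L[ℂ] HolGerm} {μ : ℂ} (hμ : μ ∈ resolventSet ℂ T)
    (y : HolGerm) : μ • resolvent T μ y - T (resolvent T μ y) = y := by
  rw [← algebraMap_sub_apply]
  exact DFunLike.congr_fun (Ring.mul_inverse_cancel _ hμ) y

theorem one_div_mem_pointSpectrum_cesaroCLM (n : ℕ) :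
    1 / ((n : ℂ) + 1) ∈ pointSpectrum cesaroCLM := by
  intro hinj
  have hb : ∀ j, ‖(j.choose n : ℂ)‖ ≤ 1 * 2 ^ j := fun j => by
    rw [Complex.norm_natCast, one_mul]
    exact_mod_cast Nat.choose_le_two_pow j n
  obtain ⟨g, hg⟩ := exists_coeff_eq two_pos hb
  have h0 : g = 0 := hinj (coeff_injective (funext fun j => by
    simp only [coeff_smul_sub_cesaroCLM]
    rw [hg, cesaroSeq_choose, sub_self]
    rw [← coeff_smul_sub_cesaroCLM, map_zero, smul_zero, sub_zero]
    exact (congrFun (map_zero coeffLin) j).symm))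
  have h1 : coeff g n = 0 := by rw [h0]; exact congrFun (map_zero coeffLin) n
  simp [hg] at h1

theorem pointSpectrum_subset_spectrum (T : HolGerm →L[ℂ] HolGerm) :
    pointSpectrum T ⊆ spectrum ℂ T := by
  intro μ hμ hres
  refine hμ fun x y hxy => ?_
  have h : ∀ z, resolvent T μ (μ • z - T z) = z := fun z => by
    rw [← algebraMap_sub_apply]
    exact DFunLike.congr_fun (Ring.inverse_mul_cancel _ hres) z
  rw [← h x, ← h y]
  exact congrArg _ hxy

/-- The points `1 / (n + 1)` together with their limit `0` form a closed set; half the distance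
available at `μ` serves both as radius and as lower bound. -/
theorem exists_pos_le_norm_sub {μ : ℂ} (h0 : μ ≠ 0) (hμ : ∀ n : ℕ, μ ≠ 1 / ((n : ℂ) + 1)) :
    ∃ d : ℝ, 0 < d ∧ ∀ ν ∈ Metric.ball μ d, ∀ n : ℕ, d ≤ ‖ν - 1 / ((n : ℂ) + 1)‖ := by
  have hlim : Tendsto (fun n : ℕ => 1 / ((n : ℂ) + 1)) atTop (𝓝 0) :=
    tendsto_one_div_add_atTop_nhds_zero_nat
  have hcl := hlim.isCompact_insert_range.isClosed
  have hmem : μ ∈ (insert 0 (range fun n : ℕ => 1 / ((n : ℂ) + 1)))ᶜ := by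
    rintro (h | ⟨n, h⟩)
    · exact h0 h
    · exact hμ n h.symm
  obtain ⟨ε, hε, hball⟩ := Metric.isOpen_iff.1 hcl.isOpen_compl μ hmem
  refine ⟨ε / 2, by positivity, fun ν hν n => ?_⟩
  by_contra! hlt
  refine hball (?_ : 1 / ((n : ℂ) + 1) ∈ Metric.ball μ ε) (Or.inr ⟨n, rfl⟩)
  rw [Metric.mem_ball, dist_comm] at hν ⊢
  rw [← dist_eq_norm] at hlt
  linarith [dist_triangle μ ν (1 / ((n : ℂ) + 1))]

theorem mem_resolventSetStar_cesaroCLM {μ : ℂ} (h0 : μ ≠ 0)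
    (hμ : ∀ n : ℕ, μ ≠ 1 / ((n : ℂ) + 1)) : μ ∈ resolventSetStar cesaroCLM := by
  obtain ⟨d, hd, hball⟩ := exists_pos_le_norm_sub h0 hμ
  have hres : Metric.ball μ d ⊆ resolventSet ℂ cesaroCLM := fun ν hν =>
    mem_resolventSet_cesaroCLM hd (hball ν hν)
  refine ⟨d, hd, hres, ?_⟩
  refine equicontinuous_of_coeffBound
    (fun ν : Metric.ball μ d => (resolvent cesaroCLM (ν : ℂ)).toLinearMap) fun R hR => ?_
  refine ⟨R + 2 / d, 2 / d, by positivity, fun ν g A hg => ?_⟩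
  refine norm_le_of_mul_sub_cesaroSeq_eq hd (hball ν ν.2) hR (fun n => ?_) hg
  rw [← coeff_smul_sub_cesaroCLM]
  exact congrArg (fun g => coeff g n) (smul_resolvent_sub (hres ν.2) g)

theorem setOf_one_div_eq_range :
    {μ : ℂ | ∃ n : ℕ, 0 < n ∧ μ = 1 / (n : ℂ)} = range fun n : ℕ => 1 / ((n : ℂ) + 1) := by
  ext μ
  constructor
  · rintro ⟨n, hn, rfl⟩
    obtain ⟨m, rfl⟩ := Nat.exists_eq_succ_of_ne_zero hn.ne'
    exact ⟨m, by simp⟩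
  · rintro ⟨n, rfl⟩
    exact ⟨n + 1, n.succ_pos, by simp⟩

theorem spectrum_and_pointSpectrum_cesaroCLM :
    spectrum ℂ cesaroCLM = range (fun n : ℕ => 1 / ((n : ℂ) + 1)) ∧
      pointSpectrum cesaroCLM = range fun n : ℕ => 1 / ((n : ℂ) + 1) := by
  have h1 : range (fun n : ℕ => 1 / ((n : ℂ) + 1)) ⊆ pointSpectrum cesaroCLM := by
    rintro _ ⟨n, rfl⟩
    exact one_div_mem_pointSpectrum_cesaroCLM n
  have h2 := pointSpectrum_subset_spectrum cesaroCLM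
  have h3 : spectrum ℂ cesaroCLM ⊆ range fun n : ℕ => 1 / ((n : ℂ) + 1) := by
    intro μ hμ
    by_contra hn
    refine hμ ?_
    by_cases h0 : μ = 0
    · exact h0 ▸ zero_mem_resolventSet_cesaroCLM
    · obtain ⟨d, hd, hball⟩ := exists_pos_le_norm_sub h0 fun n h => hn ⟨n, h.symm⟩
      exact mem_resolventSet_cesaroCLM hd (hball μ (Metric.mem_ball_self hd))
  exact ⟨h3.antisymm (h1.trans h2), (h2.trans h3).antisymm h1⟩

theorem spectrumStar_cesaroCLM :
    spectrumStar cesaroCLM = {0} ∪ range fun n : ℕ => 1 / ((n : ℂ) + 1) := by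
  have hspec := spectrum_and_pointSpectrum_cesaroCLM.1
  ext μ
  constructor
  · intro hμ
    by_contra hn
    rw [mem_union, not_or] at hn
    exact hμ (mem_resolventSetStar_cesaroCLM hn.1 fun n h => hn.2 ⟨n, h.symm⟩)
  · rintro hμ ⟨δ, hδ, hball, -⟩
    have hd : ∀ n : ℕ, 1 / ((n : ℂ) + 1) ∉ Metric.ball μ δ := fun n hn =>
      (hspec.ge ⟨n, rfl⟩ : 1 / ((n : ℂ) + 1) ∈ spectrum ℂ cesaroCLM) (hball hn)
    -- Although `0` is in the resolvent set, every disc around it contains eigenvalues.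
    rcases hμ with rfl | ⟨n, rfl⟩
    · have hlim : Tendsto (fun n : ℕ => 1 / ((n : ℂ) + 1)) atTop (𝓝 0) :=
        tendsto_one_div_add_atTop_nhds_zero_nat
      obtain ⟨n, hn⟩ := (hlim.eventually (Metric.ball_mem_nhds 0 hδ)).exists
      exact hd n hn
    · exact hd n (Metric.mem_ball_self hδ)

/-! ### Failure of weak compactness -/

theorem exists_pos_coeffBound_mem {U : Set HolGerm} (hU : U ∈ 𝓝 (0 : HolGerm)) {R : ℝ}
    (hR : 0 < R) : ∃ ε : ℝ, 0 < ε ∧ ∀ g, CoeffBound g ε R → g ∈ U := by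
  obtain ⟨k, hk⟩ := exists_stepRadius_mul_le R
  have hpre := (continuous_discToGerm k).continuousAt (x := 0) |>.preimage_mem_nhds
    (by rwa [map_zero])
  obtain ⟨δ, hδ, hball⟩ := Metric.mem_nhds_iff.1 hpre
  refine ⟨δ / 3, by positivity, fun g hg => ?_⟩
  obtain ⟨u, rfl, hu⟩ := hg.exists_discToGerm hR (stepRadius_pos k) hk
  exact hball (mem_ball_zero_iff.2 (by linarith))

/-- The topological dual of `H₀` contains, for every sequence of weights `v k ≤ (2 / (k + 1)) ^ n k`
at strictly increasing positions `n k`, the functional `g ↦ ∑ v k * coeff g (n k)`. -/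
theorem exists_functional_eq_tsum {n : ℕ → ℕ} (hn : StrictMono n) {v : ℕ → ℂ}
    (hv : ∀ k, ‖v k‖ ≤ (2 / ((k : ℝ) + 1)) ^ n k) :
    ∃ φ : HolGerm →L[ℂ] ℂ, ∀ g, φ g = ∑' k, v k * coeff g (n k) := by
  have hterm : ∀ {g A R}, 1 ≤ R → CoeffBound g A R → ∀ k,
      ‖v k * coeff g (n k)‖ ≤ (2 * R / ((k : ℝ) + 1)) ^ n k * A := by
    intro g A R hR hg k
    rw [norm_mul]
    calc ‖v k‖ * ‖coeff g (n k)‖ ≤ (2 / ((k : ℝ) + 1)) ^ n k * (A * R ^ n k) := by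
          gcongr
          · exact hv k
          · exact hg _
      _ = (2 * R / ((k : ℝ) + 1)) ^ n k * A := by
          rw [mul_div_right_comm, mul_pow]; ring
  have hsum : ∀ R : ℝ, 1 ≤ R → Summable fun k : ℕ => (2 * R / ((k : ℝ) + 1)) ^ n k := by
    intro R hR
    refine Summable.of_norm_bounded_eventually_nat
      (summable_geometric_of_lt_one (r := 1 / 2) (by norm_num) (by norm_num)) ?_
    -- For `k ≥ 4 * R` the base is at most `1 / 2`, and `n k ≥ k`, so the terms are dominated by
    -- `2⁻ᵏ`.
    filter_upwards [eventually_ge_atTop ⌈4 * R⌉₊] with k hk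
    have hk' : 4 * R ≤ k := (Nat.le_ceil _).trans (by exact_mod_cast hk)
    have hle : 2 * R / ((k : ℝ) + 1) ≤ 1 / 2 := by
      rw [div_le_div_iff₀ (by positivity) two_pos]
      linarith
    rw [Real.norm_of_nonneg (by positivity)]
    calc (2 * R / ((k : ℝ) + 1)) ^ n k ≤ (1 / 2) ^ n k := by gcongr
      _ ≤ (1 / 2) ^ k :=
        pow_le_pow_of_le_one (by norm_num) (by norm_num) hn.le_apply
  have hsummable : ∀ g, Summable fun k => v k * coeff g (n k) := by
    intro g
    obtain ⟨A, R, hR, hg⟩ := exists_coeffBound g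
    exact .of_norm_bounded ((hsum R hR).mul_right A) (hterm hR hg)
  let φ : HolGerm →ₗ[ℂ] ℂ :=
    { toFun := fun g => ∑' k, v k * coeff g (n k)
      map_add' := fun g h => by
        rw [← (hsummable g).tsum_add (hsummable h)]
        simp only [coeff_add, Pi.add_apply, mul_add]
      map_smul' := fun c g => by
        rw [RingHom.id_apply, smul_eq_mul, ← tsum_mul_left]
        simp only [coeff_smul, Pi.smul_apply, smul_eq_mul, mul_left_comm] }
  refine ⟨⟨φ, continuous_functional_of_coeffBound φ fun R hR =>
    ⟨∑' k : ℕ, (2 * R / ((k : ℝ) + 1)) ^ n k, fun g A hg => ?_⟩⟩, fun g => rfl⟩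
  rw [← tsum_mul_right]
  exact tsum_of_norm_bounded ((hsum R hR).mul_right A).hasSum (hterm hR hg)

/-- No neighbourhood of `0` in `H₀` is weakly bounded. -/
theorem exists_functional_unbounded {U : Set HolGerm} (hU : U ∈ 𝓝 (0 : HolGerm)) :
    ∃ φ : HolGerm →L[ℂ] ℂ, ∀ k : ℕ, ∃ g ∈ U, φ g = (k : ℂ) + 1 := by
  have hpos : ∀ k : ℕ, (0 : ℝ) < (k : ℝ) + 1 := fun k => by positivity
  -- The rate `k + 1` grows with `k`. The monomial of degree `n k` with coefficient `ε k * (k + 1) ^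
  -- n k` lies in `U`, and the weight below is chosen so that `φ` takes the value `k + 1` on it; a
  -- large `n k` makes that weight admissible.
  choose ε hε hεU using fun k : ℕ => exists_pos_coeffBound_mem hU (hpos k)
  obtain ⟨n, hn, hn2⟩ : ∃ n : ℕ → ℕ, StrictMono n ∧ ∀ k : ℕ, ((k : ℝ) + 1) / ε k ≤ 2 ^ n k :=
    extraction_forall_of_eventually (P := fun (k m : ℕ) => ((k : ℝ) + 1) / ε k ≤ 2 ^ m) fun k =>
      (tendsto_pow_atTop_atTop_of_one_lt one_lt_two).eventually_ge_atTop _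
  obtain ⟨φ, hφ⟩ := exists_functional_eq_tsum hn
    (v := fun k => ((((k : ℝ) + 1) / (ε k * ((k : ℝ) + 1) ^ n k) : ℝ) : ℂ)) fun k => by
      have := hε k
      rw [Complex.norm_real, Real.norm_of_nonneg (by positivity), ← div_div, div_pow]
      gcongr
      exact hn2 k
  refine ⟨φ, fun k => ?_⟩
  let c : ℝ := ε k * ((k : ℝ) + 1) ^ n k
  have hc : 0 < c := mul_pos (hε k) (pow_pos (hpos k) _)
  have hb : ∀ m, ‖(Pi.single (n k) (c : ℂ) : ℕ → ℂ) m‖ ≤ ε k * ((k : ℝ) + 1) ^ m := by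
    intro m
    rcases eq_or_ne m (n k) with rfl | hm
    · rw [Pi.single_eq_same, Complex.norm_real, Real.norm_of_nonneg hc.le]
    · rw [Pi.single_eq_of_ne hm, norm_zero]
      have := hε k
      positivity
  obtain ⟨g, hg⟩ := exists_coeff_eq (hpos k) hb
  refine ⟨g, hεU k g fun m => by rw [hg]; exact hb m, ?_⟩
  rw [hφ, tsum_eq_single k fun j hj => by
    rw [hg, Pi.single_eq_of_ne (hn.injective.ne hj), mul_zero], hg, Pi.single_eq_same,
    ← Complex.ofReal_mul, div_mul_cancel₀ _ hc.ne']
  push_cast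
  rfl

theorem _root_.IsCompactOperator.isWeaklyCompactOperator {E : Type*} [AddCommGroup E] [Module ℂ E]
    [TopologicalSpace E] [IsTopologicalAddGroup E] [ContinuousConstSMul ℂ E] {T : E →L[ℂ] E}
    (h : IsCompactOperator T) : IsWeaklyCompactOperator T := by
  obtain ⟨K, hK, hKT⟩ := h
  refine ⟨toWeakSpaceCLM ℂ E '' K, hK.image (toWeakSpaceCLM ℂ E).continuous, ?_⟩
  exact mem_of_superset hKT fun x hx => ⟨T x, hx, rfl⟩

/-- With `S` the inverse of `T`, the functional `φ ∘L S` is weakly continuous, hence bounded on the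
weakly compact `K`. So `φ` is bounded on the preimage of `K`, a neighbourhood of `0`. -/
theorem not_isWeaklyCompactOperator_of_isUnit {T : HolGerm →L[ℂ] HolGerm} (hT : IsUnit T) :
    ¬ IsWeaklyCompactOperator T := by
  rintro ⟨K, hK, hKT⟩
  obtain ⟨φ, hφ⟩ := exists_functional_unbounded hKT
  obtain ⟨S, -, hST⟩ := isUnit_iff_exists.1 hT
  have hcont : Continuous fun w : WeakSpace ℂ HolGerm =>
      (φ ∘L S) ((toWeakSpace ℂ HolGerm).symm w) :=
    WeakBilin.eval_continuous (topDualPairing ℂ HolGerm).flip (φ ∘L S)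
  obtain ⟨M, hM⟩ := hK.exists_bound_of_continuousOn hcont.continuousOn
  obtain ⟨k, hk⟩ := exists_nat_ge M
  obtain ⟨g, hg, hgk⟩ := hφ k
  have h1 : (φ ∘L S) (T g) = φ g := congrArg φ (DFunLike.congr_fun hST g)
  have h2 : ‖(φ ∘L S) (T g)‖ ≤ M := hM _ hg
  rw [h1, hgk, norm_natCast_add_one] at h2
  linarith

theorem isUnit_cesaroCLM : IsUnit cesaroCLM := by
  have h := zero_mem_resolventSet_cesaroCLM
  rw [spectrum.mem_resolventSet_iff, map_zero, zero_sub] at h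
  exact (IsUnit.neg_iff _).1 h

end HolGerm

end

theorem proposition2p14 :
    ∃ C : HolGerm →L[ℂ] HolGerm,
      (∀ g : HolGerm, C g = HolGerm.cesaro g) ∧
      spectrum ℂ C = {μ : ℂ | ∃ n : ℕ, 0 < n ∧ μ = 1 / (n : ℂ)} ∧
      pointSpectrum C = {μ : ℂ | ∃ n : ℕ, 0 < n ∧ μ = 1 / (n : ℂ)} ∧
      spectrumStar C = {0} ∪ {μ : ℂ | ∃ n : ℕ, 0 < n ∧ μ = 1 / (n : ℂ)} ∧
      ¬ IsCompactOperator C ∧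
      ¬ IsWeaklyCompactOperator C := by
  have hwc := HolGerm.not_isWeaklyCompactOperator_of_isUnit HolGerm.isUnit_cesaroCLM
  obtain ⟨hs, hp⟩ := HolGerm.spectrum_and_pointSpectrum_cesaroCLM
  rw [HolGerm.setOf_one_div_eq_range]
  exact ⟨HolGerm.cesaroCLM, fun _ => rfl, hs, hp, HolGerm.spectrumStar_cesaroCLM,
    fun h => hwc h.isWeaklyCompactOperator, hwc⟩
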